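/- Let $\Phi$ be the set of continuous functions $\varphi:[0,\infty)\to\mathbb R$ such that $\varphi(z)=0\Leftrightarrow z=0$, the function $h(y)=\varphi(e^{y})$ is strictly increasing and convex on $\mathbb R$, and $\sum_{k\ge 3}\exp(h(k)-h(k+1))<\infty$. For $C_1,C_2>0$ put $$N(\varphi;u)=C_2|u|\ \ (|u|\le C_1),\qquad N(\varphi;u)=\exp\varphi(|u|)\ \ (|u|>C_1),$$ and call $(C_1,C_2)$ admissible for $\varphi$ if $N(\varphi;\cdot)$ is an Orlicz function, i.e. even, continuous, convex, nonnegative, zero only at $0$, and strictly increasing on $[0,\infty)$. Let $\mu$ be normalized Lebesgue measure on $[-1,1]$, $\mu([-1,1])=1$, and let $$\|f\|_{B(\varphi)}=\inf\Big\{l>0:\ \int_{-1}^{1} N(\varphi;|f|/l)\,d\mu\le 1\Big\},\qquad W(\varphi,n)=\sup_{Q}\frac{\|Q'\|_{B(\varphi)}}{\|Q\|_{B(\varphi)}},$$ where the supremum is over all nonzero real algebraic polynomials $Q$ of degree exactly $n$. Put further $h^*(p)=\sup_{y\in\mathbb R}(py-h(y))$, $\psi(p)=\exp(h^*(p)/p)$,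 $K(p)=\left[\dfrac{4\pi(p+3)^2}{p\sin(2\pi/p)}\right]^{1/p}$ (so $K(4)=(49\pi)^{1/4}$), $C_3=\max(1,C_1,1/C_2)$, $k_0=\max\{4+\max(\log C_1,1),\,(h^*)'_+(1)\}$, where $(h^*)'_+$ is the right derivative, and $$C_4=e^{2}\Big[N(\varphi;e^{k_0-2})+\sum_{k\in\mathbb Z,\ k\ge k_0}\exp(h(k-1)-h(k))\Big].$$ **Theorem 1.** Let $\varphi\in\Phi$. Admissible pairs $(C_1,C_2)$ for $\varphi$ exist, and for every such pair there is a constant $C_5=C_5(\varphi)\in(0,\infty)$ (for the chosen $C_1=C_1(\varphi)$, $C_2=C_2(\varphi)$) such that for all integers $n\ge 0$ $$C_5\,n^2\ \le\ W(\varphi,n)\ \le\ n^2\cdot K(4)\cdot\max(1,\psi(4))\cdot C_4\cdot C_3 .$$ -/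

import Mathlib

open MeasureTheory Set Polynomial
open scoped ENNReal

noncomputable section

/-- `h(y) = φ(exp y)`. -/
def expComp (φ : ℝ → ℝ) (y : ℝ) : ℝ := φ (Real.exp y)

/-- The class `Φ`. Only the values of `φ` on `[0, ∞)` matter. The terms of the series are positive,
so `Summable` says that its sum over the integers `k ≥ 3` is finite. -/
structure IsPhi (φ : ℝ → ℝ) : Prop where
  continuousOn : ContinuousOn φ (Ici 0)
  eq_zero_iff : ∀ z, 0 ≤ z → (φ z = 0 ↔ z = 0)
  strictMono : StrictMono (expComp φ)
  convexOn : ConvexOn ℝ univ (expComp φ)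
  summable : Summable fun k : {k : ℕ // 3 ≤ k} =>
    Real.exp (expComp φ (k : ℕ) - expComp φ ((k : ℕ) + 1))

/-- `N`-Orlicz functions. -/
structure IsNOrlicz (N : ℝ → ℝ) : Prop where
  even : ∀ u, N (-u) = N u
  continuous : Continuous N
  convexOn : ConvexOn ℝ univ N
  nonneg : ∀ u, 0 ≤ N u
  eq_zero_iff : ∀ u, N u = 0 ↔ u = 0
  strictMonoOn : StrictMonoOn N (Ici 0)

/-- `N(φ; u)`, equal to `C₂ |u|` for `|u| ≤ C₁` and to `exp (φ |u|)` for `|u| > C₁`. -/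
def expOrlicz (φ : ℝ → ℝ) (C₁ C₂ u : ℝ) : ℝ :=
  if |u| ≤ C₁ then C₂ * |u| else Real.exp (φ |u|)

/-- `C₁`, `C₂` are positive constants for which `N(φ; ·)` is an `N`-Orlicz function. -/
structure IsAdmissible (φ : ℝ → ℝ) (C₁ C₂ : ℝ) : Prop where
  pos₁ : 0 < C₁
  pos₂ : 0 < C₂
  isNOrlicz : IsNOrlicz (expOrlicz φ C₁ C₂)

/-- Normalized Lebesgue measure on `[-1, 1]`. -/
def normLebesgue : Measure ℝ := (2⁻¹ : ℝ≥0∞) • volume.restrict (Icc (-1) 1)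

/-- The Orlicz (Luxemburg) norm of the restriction of `f` to `[-1, 1]`:
`inf {l > 0 : ∫ N(|f| / l) dμ ≤ 1}`, with value `∞` if there is no such `l`. -/
def orliczNorm (N : ℝ → ℝ) (f : ℝ → ℝ) : ℝ≥0∞ :=
  ⨅ (l : ℝ) (_ : 0 < l ∧ ∫⁻ x, ENNReal.ofReal (N (|f x| / l)) ∂normLebesgue ≤ 1),
    ENNReal.ofReal l

/-- The norm of the exponential Orlicz space `B(φ)`. -/
def expOrliczNorm (φ : ℝ → ℝ) (C₁ C₂ : ℝ) (f : ℝ → ℝ) : ℝ≥0∞ :=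
  orliczNorm (expOrlicz φ C₁ C₂) f

/-- The Markov constant `W(φ, n)`: the supremum of `‖Q'‖ / ‖Q‖` in `B(φ)` over the nonzero
polynomials of degree `n`. -/
def markovConst (φ : ℝ → ℝ) (C₁ C₂ : ℝ) (n : ℕ) : ℝ≥0∞ :=
  ⨆ (Q : ℝ[X]) (_ : Q ≠ 0 ∧ Q.natDegree = n),
    expOrliczNorm φ C₁ C₂ (fun x => Q.derivative.eval x) /
      expOrliczNorm φ C₁ C₂ (fun x => Q.eval x)

/-- The Young-Fenchel (Legendre) transform `h*(p) = sup_y (p y - h(y))`. For `h(y) = φ(exp y)` with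
`φ` in `Φ` the supremum is finite for every `p ≥ 0`. -/
def legendreTransform (h : ℝ → ℝ) (p : ℝ) : ℝ := ⨆ y : ℝ, (p * y - h y)

/-- `ψ(p) = exp(h*(p) / p)`. -/
def psiFun (φ : ℝ → ℝ) (p : ℝ) : ℝ := Real.exp (legendreTransform (expComp φ) p / p)

/-- `K(p) = [4 π (p + 3)² / (p sin(2 π / p))] ^ (1 / p)`. -/
def baranK (p : ℝ) : ℝ :=
  (4 * Real.pi * (p + 3) ^ 2 / (p * Real.sin (2 * Real.pi / p))) ^ (1 / p)

/-- `C₃ = max(1, C₁, 1 / C₂)`. -/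
def constC3 (C₁ C₂ : ℝ) : ℝ := max 1 (max C₁ (1 / C₂))

/-- `k₀ = max {4 + max(log C₁, 1), (h*)'₊(1)}`, where the last term is a right derivative. -/
def constK0 (φ : ℝ → ℝ) (C₁ : ℝ) : ℝ :=
  max (4 + max (Real.log C₁) 1) (derivWithin (legendreTransform (expComp φ)) (Ioi 1) 1)

/-- `C₄ = e² [N(φ; exp(k₀ - 2)) + ∑_{k ≥ k₀} exp(h(k - 1) - h(k))]`, the sum being over the
integers `k ≥ k₀` (all of them are positive, as `k₀ ≥ 5`). -/
def constC4 (φ : ℝ → ℝ) (C₁ C₂ : ℝ) : ℝ :=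
  Real.exp 2 * (expOrlicz φ C₁ C₂ (Real.exp (constK0 φ C₁ - 2)) +
    ∑' k : {k : ℕ // constK0 φ C₁ ≤ (k : ℝ)},
      Real.exp (expComp φ ((k : ℕ) - 1) - expComp φ (k : ℕ)))

end

/-!
The two inequalities hold in the Orlicz space of every Orlicz function `N`, with constants that do
not depend on `N`.

*Upper bound.* Lagrange interpolation at the extremal points of the Chebyshev polynomial `T_n`
writes `P'(1)` as a combination of values of `P` on `[-1, 1]` whose coefficients have absolute
values adding up to `T_n'(1) = n²` (`exists_derivative_eval_one_eq_sum`). For `x` in `[0, 1]` the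
interval `[x - 1, x]` is contained in `[-1, 1]` and has `x` as its right endpoint; the formula,
moved there, expresses `Q'` on `[0, 1]` by translates of `Q`. Since translations preserve Lebesgue
measure, Jensen's inequality bounds the modular of `Q'` on `[0, 1]` by that of `Q` on `[-1, 1]`
(`lintegral_derivative_Icc_zero_one_le`), and reflection covers `[-1, 0]`. The result is
`‖Q'‖ ≤ 4 n² ‖Q‖` (`orliczNorm_derivative_le`). As `K(4) ≥ 1` and `C₃ C₄ ≥ e⁵`
(`IsAdmissible.exp_five_le_constC4_mul_constC3`), this is stronger than the bound of the theorem.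

*Lower bound.* There is a polynomial `Q` of degree `n` that is bounded by `1` on `[-1, 1]`, rises
from `0` to `1` on an interval `[a, 1]` of length `O(n⁻²)`, and has integral `O(n⁻²)`: a multiple of
`U_m ^ 4 * X ^ r`, where `U_m` is the Chebyshev polynomial of the second kind
(`exists_peaked_polynomial`). Jensen's inequality on `[a, 1]` bounds the modular of `Q'` from below,
convexity bounds the modular of `Q` from above, and the two bounds compare `‖Q'‖` with `n² ‖Q‖`
(`exists_natDegree_eq_le_orliczNorm_div`).

*Admissible constants.* Convergence of the series forces the increments of `h` to exceed `1`
somewhere. From such a point `y₀` on all supporting lines of `h` have slope at least `1`, and this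
makes the function glued at `C₁ = exp y₀` convex (`IsPhi.isAdmissible`).
-/

/-! ### Orlicz functions and Orlicz norms -/

namespace IsNOrlicz

lemma apply_zero {N : ℝ → ℝ} (hN : IsNOrlicz N) : N 0 = 0 := (hN.eq_zero_iff 0).2 rfl

lemma apply_abs {N : ℝ → ℝ} (hN : IsNOrlicz N) (u : ℝ) : N |u| = N u := by
  rcases abs_choice u with h | h <;> rw [h]
  exact hN.even u

lemma apply_le_apply {N : ℝ → ℝ} (hN : IsNOrlicz N) {u v : ℝ} (h : |u| ≤ |v|) : N u ≤ N v := by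
  rw [← hN.apply_abs u, ← hN.apply_abs v]
  exact hN.strictMonoOn.monotoneOn (abs_nonneg u) (abs_nonneg v) h

lemma apply_mul_le {N : ℝ → ℝ} (hN : IsNOrlicz N) {t : ℝ} (h0 : 0 ≤ t) (h1 : t ≤ 1) (u : ℝ) :
    N (t * u) ≤ t * N u := by
  have := hN.convexOn.2 (mem_univ u) (mem_univ 0) h0 (sub_nonneg.2 h1) (by ring)
  simpa [hN.apply_zero] using this

lemma mul_le_apply_mul {N : ℝ → ℝ} (hN : IsNOrlicz N) {t : ℝ} (ht : 1 ≤ t) (u : ℝ) :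
    t * N u ≤ N (t * u) := by
  have ht0 : 0 < t := by linarith
  have := hN.apply_mul_le (inv_nonneg.2 ht0.le) (inv_le_one_of_one_le₀ ht) (t * u)
  rw [inv_mul_cancel_left₀ ht0.ne'] at this
  calc t * N u ≤ t * (t⁻¹ * N (t * u)) := by gcongr
    _ = N (t * u) := mul_inv_cancel_left₀ ht0.ne' _

end IsNOrlicz

lemma lintegral_normLebesgue (f : ℝ → ℝ≥0∞) :
    ∫⁻ x, f x ∂normLebesgue = 2⁻¹ * ∫⁻ x in Icc (-1) 1, f x := by
  rw [normLebesgue, lintegral_smul_measure, smul_eq_mul]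

lemma orliczNorm_le {N f : ℝ → ℝ} {l : ℝ} (hl : 0 < l)
    (h : ∫⁻ x, ENNReal.ofReal (N (|f x| / l)) ∂normLebesgue ≤ 1) :
    orliczNorm N f ≤ ENNReal.ofReal l :=
  iInf₂_le l ⟨hl, h⟩

lemma le_mul_orliczNorm {N f : ℝ → ℝ} {a : ℝ≥0∞} {k : ℝ} (hk : 0 < k)
    (h : ∀ l, 0 < l → ∫⁻ x, ENNReal.ofReal (N (|f x| / l)) ∂normLebesgue ≤ 1 →
      a ≤ ENNReal.ofReal (k * l)) :
    a ≤ ENNReal.ofReal k * orliczNorm N f := by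
  have hk0 : ENNReal.ofReal k ≠ 0 := by simpa using hk
  rw [orliczNorm, ENNReal.mul_iInf_of_ne hk0 ENNReal.ofReal_ne_top]
  refine le_iInf fun l => ?_
  rw [ENNReal.mul_iInf_of_ne hk0 ENNReal.ofReal_ne_top]
  refine le_iInf fun hl => ?_
  rw [← ENNReal.ofReal_mul hk.le]
  exact h l hl.1 hl.2

/-! ### The Markov inequality in Orlicz spaces -/

open Polynomial.Chebyshev in
/-- The derivative at the endpoint `1` is a combination of the values at the extremal points of
`T_n`. The coefficients alternate in sign, exactly like the values of `T_n` at these points, so that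
their absolute values add up to `T_n'(1) = n ^ 2`. -/
lemma exists_derivative_eval_one_eq_sum (n : ℕ) : ∃ c : ℕ → ℝ,
    ∑ i ∈ Finset.range (n + 1), |c i| = (n : ℝ) ^ 2 ∧
    ∀ P : ℝ[X], P.natDegree ≤ n →
      P.derivative.eval 1 = ∑ i ∈ Finset.range (n + 1), c i * P.eval (node n i) := by
  rcases Nat.eq_zero_or_pos n with rfl | hn
  · refine ⟨0, by simp, fun P hP => ?_⟩
    rw [derivative_of_natDegree_zero (by omega)]
    simp
  set s := Finset.range (n + 1) with hs
  set c : ℕ → ℝ := fun i => (∏ j ∈ s.erase i, (node n i - node n j))⁻¹ *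
    ∑ t ∈ (s.erase i).powersetCard (s.card - (1 + 1)), ∏ a ∈ t, (1 - node n a) with hc
  have key : ∀ P : ℝ[X], P.natDegree ≤ n →
      P.derivative.eval 1 = ∑ i ∈ s, c i * P.eval (node n i) := by
    intro P hP
    have hdeg : P.degree < s.card := by
      rw [hs, Finset.card_range]
      exact (degree_le_of_natDegree_le hP).trans_lt (by exact_mod_cast Nat.lt_succ_self n)
    have := Lagrange.eval_iterate_derivative_eq_sum (strictAntiOn_node n).injOn hdeg
      (k := 1) (by rw [Finset.card_range]; omega) 1
    rw [Function.iterate_one] at this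
    rw [this, Nat.factorial_one, Nat.cast_one, one_mul]
    refine Finset.sum_congr rfl fun i _ => ?_
    simp only [hc]
    ring
  have hsign : ∀ i ∈ s, |c i| = c i * (T ℝ n).eval (node n i) := by
    intro i hi
    have hin : i ≤ n := Nat.lt_succ_iff.1 (Finset.mem_range.1 hi)
    have hpos : 0 ≤ (-1) ^ i * c i := by
      rw [hc]
      dsimp only
      rw [← mul_assoc]
      refine mul_nonneg ?_ (Finset.sum_nonneg fun t _ => Finset.prod_nonneg fun a _ =>
        sub_nonneg.2 node_mem_Icc.2)
      have := inv_nonneg.2 (zero_lt_prod_node_sub_node hin).le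
      rwa [mul_inv, ← inv_pow, inv_neg_one] at this
    rw [eval_T_real_node (Finset.mem_Iic.2 hin), mul_comm, ← abs_of_nonneg hpos, abs_mul _ (c i),
      abs_neg_one_pow, one_mul]
  refine ⟨c, ?_, key⟩
  rw [Finset.sum_congr rfl hsign, ← key _ (by simp), T_derivative_eq_U]
  simp [U_eval_one, sq]

/-- Every interval `[x - 1, x]` with `x ∈ [0, 1]` lies in `[-1, 1]`, so that the endpoint formula,
moved to `[x - 1, x]`, writes `Q'` on `[0, 1]` as a combination of translates of `Q`. Translations
preserve the measure, and Jensen's inequality gives the estimate. -/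
lemma lintegral_derivative_Icc_zero_one_le {N : ℝ → ℝ} (hN : IsNOrlicz N) {Q : ℝ[X]} {n : ℕ}
    (hn : 0 < n) (hQ : Q.natDegree ≤ n) {l : ℝ} (hl : 0 < l) :
    ∫⁻ x in Icc 0 1, ENNReal.ofReal (N (|Q.derivative.eval x| / (2 * n ^ 2 * l))) ≤
      ∫⁻ x in Icc (-1) 1, ENNReal.ofReal (N (|Q.eval x| / l)) := by
  obtain ⟨c, hc, hform⟩ := exists_derivative_eval_one_eq_sum n
  have hn' : (0 : ℝ) < (n : ℝ) ^ 2 := by positivity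
  set s := Finset.range (n + 1)
  set σ : ℕ → ℝ := fun i => (1 - Chebyshev.node n i) / 2 with hσ
  set w : ℕ → ℝ := fun i => |c i| / n ^ 2 with hw
  have hw0 : ∀ i, 0 ≤ w i := fun i => by positivity
  have hw1 : ∑ i ∈ s, w i = 1 := by rw [hw, ← Finset.sum_div, hc, div_self hn'.ne']
  have hrep : ∀ x, Q.derivative.eval x = 2 * ∑ i ∈ s, c i * Q.eval (x - σ i) := by
    intro x
    have := hform (Q.comp (C 2⁻¹ * X + C (x - 2⁻¹))) (by
      rw [natDegree_comp]
      calc Q.natDegree * (C (2⁻¹ : ℝ) * X + C (x - 2⁻¹)).natDegree ≤ Q.natDegree * 1 :=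
            Nat.mul_le_mul_left _ natDegree_linear_le
        _ ≤ n := by simpa using hQ)
    rw [derivative_comp] at this
    simp only [derivative_add, derivative_mul, derivative_C, derivative_X, eval_mul, eval_comp,
      eval_add, eval_C, eval_X, zero_mul, zero_add, mul_one, add_zero] at this
    rw [show (2⁻¹ : ℝ) + (x - 2⁻¹) = x by ring] at this
    have h2 : Q.derivative.eval x = 2 * (2⁻¹ * Q.derivative.eval x) := by ring
    rw [h2, this]
    congr 1
    refine Finset.sum_congr rfl fun i _ => ?_
    congr 2
    simp only [hσ]
    ring
  have hpt : ∀ x, N (|Q.derivative.eval x| / (2 * n ^ 2 * l)) ≤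
      ∑ i ∈ s, w i * N (|Q.eval (x - σ i)| / l) := by
    intro x
    have h1 : |Q.derivative.eval x| / (2 * n ^ 2 * l) ≤
        ∑ i ∈ s, w i • (|Q.eval (x - σ i)| / l) := by
      rw [hrep, abs_mul, abs_two, div_le_iff₀ (by positivity), Finset.sum_mul, mul_comm]
      calc |∑ i ∈ s, c i * Q.eval (x - σ i)| * 2
          ≤ (∑ i ∈ s, |c i * Q.eval (x - σ i)|) * 2 := by
            gcongr; exact Finset.abs_sum_le_sum_abs _ _
        _ = _ := by
            rw [Finset.sum_mul]
            refine Finset.sum_congr rfl fun i _ => ?_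
            simp only [hw, smul_eq_mul, abs_mul]
            field_simp
    refine (hN.apply_le_apply ?_).trans
      (hN.convexOn.map_sum_le (fun i _ => hw0 i) hw1 fun i _ => mem_univ _)
    rw [abs_of_nonneg (by positivity)]
    exact h1.trans (le_abs_self _)
  have hmeas : ∀ t : ℝ, Measurable fun x => ENNReal.ofReal (N (|Q.eval (x - t)| / l)) := by
    intro t
    refine ENNReal.measurable_ofReal.comp (hN.continuous.comp ?_).measurable
    fun_prop
  calc ∫⁻ x in Icc 0 1, ENNReal.ofReal (N (|Q.derivative.eval x| / (2 * n ^ 2 * l)))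
      ≤ ∫⁻ x in Icc 0 1, ∑ i ∈ s,
          ENNReal.ofReal (w i) * ENNReal.ofReal (N (|Q.eval (x - σ i)| / l)) := by
        refine lintegral_mono fun x => (ENNReal.ofReal_le_ofReal (hpt x)).trans_eq ?_
        rw [ENNReal.ofReal_sum_of_nonneg fun i _ => mul_nonneg (hw0 i) (hN.nonneg _)]
        exact Finset.sum_congr rfl fun i _ => ENNReal.ofReal_mul (hw0 i)
    _ = ∑ i ∈ s, ENNReal.ofReal (w i) *
          ∫⁻ x in Icc 0 1, ENNReal.ofReal (N (|Q.eval (x - σ i)| / l)) := by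
        rw [lintegral_finsetSum _ fun i _ => (hmeas _).const_mul _]
        exact Finset.sum_congr rfl fun i _ => lintegral_const_mul _ (hmeas _)
    _ ≤ ∑ i ∈ s, ENNReal.ofReal (w i) *
          ∫⁻ x in Icc (-1) 1, ENNReal.ofReal (N (|Q.eval x| / l)) := by
        refine Finset.sum_le_sum fun i _ => mul_le_mul' le_rfl ?_
        rw [← (measurePreserving_sub_right volume (σ i)).setLIntegral_comp_preimage
          measurableSet_Icc (f := fun x => ENNReal.ofReal (N (|Q.eval x| / l)))
          (by simpa using hmeas 0)]
        refine lintegral_mono_set fun x hx => ?_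
        have := Chebyshev.node_mem_Icc (n := n) (i := i)
        simp only [mem_preimage, mem_Icc, hσ] at this hx ⊢
        constructor <;> linarith
    _ = ∫⁻ x in Icc (-1) 1, ENNReal.ofReal (N (|Q.eval x| / l)) := by
        rw [← Finset.sum_mul, ← ENNReal.ofReal_sum_of_nonneg fun i _ => hw0 i, hw1]
        simp

lemma lintegral_derivative_normLebesgue_le {N : ℝ → ℝ} (hN : IsNOrlicz N) {Q : ℝ[X]} {n : ℕ}
    (hn : 0 < n) (hQ : Q.natDegree ≤ n) {l : ℝ} (hl : 0 < l) :
    ∫⁻ x, ENNReal.ofReal (N (|Q.derivative.eval x| / (4 * n ^ 2 * l))) ∂normLebesgue ≤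
      ∫⁻ x, ENNReal.ofReal (N (|Q.eval x| / l)) ∂normLebesgue := by
  have hmeas : ∀ (P : ℝ[X]) (l : ℝ), Measurable fun x => ENNReal.ofReal (N (|P.eval x| / l)) := by
    intro P l
    refine ENNReal.measurable_ofReal.comp (hN.continuous.comp ?_).measurable
    fun_prop
  have hneg := Measure.measurePreserving_neg (volume : Measure ℝ)
  have hright := lintegral_derivative_Icc_zero_one_le hN hn hQ hl
  have hleft : ∫⁻ x in Icc (-1) 0, ENNReal.ofReal (N (|Q.derivative.eval x| / (2 * n ^ 2 * l))) ≤
      ∫⁻ x in Icc (-1) 1, ENNReal.ofReal (N (|Q.eval x| / l)) := by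
    have := lintegral_derivative_Icc_zero_one_le hN hn (Q := Q.comp (-X))
      (by rw [natDegree_comp, natDegree_neg, natDegree_X, mul_one]; exact hQ) hl
    rw [← hneg.setLIntegral_comp_preimage measurableSet_Icc (hmeas _ _),
      ← hneg.setLIntegral_comp_preimage (s := Icc (-1) 1) measurableSet_Icc (hmeas _ _)]
    simpa [derivative_comp] using this
  have hhalf : ∀ x, ENNReal.ofReal (N (|Q.derivative.eval x| / (4 * n ^ 2 * l))) ≤
      2⁻¹ * ENNReal.ofReal (N (|Q.derivative.eval x| / (2 * n ^ 2 * l))) := by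
    intro x
    rw [show (2⁻¹ : ℝ≥0∞) = ENNReal.ofReal 2⁻¹ by
      rw [ENNReal.ofReal_inv_of_pos two_pos, ENNReal.ofReal_ofNat], ← ENNReal.ofReal_mul (by simp)]
    refine ENNReal.ofReal_le_ofReal ?_
    have := hN.apply_mul_le (t := 2⁻¹) (by norm_num) (by norm_num)
      (|Q.derivative.eval x| / (2 * n ^ 2 * l))
    refine (congrArg N ?_).trans_le this
    rw [show (4 * n ^ 2 * l : ℝ) = 2 * (2 * n ^ 2 * l) by ring]
    field_simp
  rw [lintegral_normLebesgue, lintegral_normLebesgue]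
  refine mul_le_mul' le_rfl ?_
  calc ∫⁻ x in Icc (-1) 1, ENNReal.ofReal (N (|Q.derivative.eval x| / (4 * n ^ 2 * l)))
      ≤ ∫⁻ x in Icc (-1) 1,
          2⁻¹ * ENNReal.ofReal (N (|Q.derivative.eval x| / (2 * n ^ 2 * l))) :=
        lintegral_mono hhalf
    _ = 2⁻¹ * ∫⁻ x in Icc (-1) 0 ∪ Icc 0 1,
          ENNReal.ofReal (N (|Q.derivative.eval x| / (2 * n ^ 2 * l))) := by
        rw [lintegral_const_mul _ (hmeas _ _), Icc_union_Icc_eq_Icc (by norm_num) (by norm_num)]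
    _ ≤ 2⁻¹ * ((∫⁻ x in Icc (-1) 1, ENNReal.ofReal (N (|Q.eval x| / l))) +
          ∫⁻ x in Icc (-1) 1, ENNReal.ofReal (N (|Q.eval x| / l))) :=
        mul_le_mul' le_rfl ((lintegral_union_le _ _ _).trans (add_le_add hleft hright))
    _ = ∫⁻ x in Icc (-1) 1, ENNReal.ofReal (N (|Q.eval x| / l)) := by
        rw [← two_mul, ← mul_assoc, ENNReal.inv_mul_cancel two_ne_zero ENNReal.ofNat_ne_top,
          one_mul]

lemma orliczNorm_derivative_le {N : ℝ → ℝ} (hN : IsNOrlicz N) (Q : ℝ[X]) :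
    orliczNorm N (fun x => Q.derivative.eval x) ≤
      ENNReal.ofReal (4 * Q.natDegree ^ 2) * orliczNorm N (fun x => Q.eval x) := by
  rcases Nat.eq_zero_or_pos Q.natDegree with h0 | hn
  · refine le_of_eq_of_le ?_ zero_le
    refine le_antisymm (ENNReal.le_of_forall_pos_le_add fun ε hε _ => ?_) zero_le
    rw [zero_add, ← ENNReal.ofReal_coe_nnreal]
    refine orliczNorm_le (by simpa using hε) ?_
    simp [derivative_of_natDegree_zero h0, hN.apply_zero]
  · refine le_mul_orliczNorm (by positivity) fun l hl h => orliczNorm_le (by positivity) ?_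
    exact (lintegral_derivative_normLebesgue_le hN hn le_rfl hl).trans h

/-! ### Peaked polynomials -/

lemma abs_eval_U_le (m : ℕ) {x : ℝ} (hx : |x| ≤ 1) :
    |(Chebyshev.U ℝ m).eval x| ≤ m + 1 := by
  have h := Chebyshev.abs_iterate_derivative_T_real_le ((m : ℤ) + 1) 1 hx
  have hpos : (0 : ℝ) < m + 1 := by positivity
  simp only [Function.iterate_one, Chebyshev.T_derivative_eq_U, add_sub_cancel_right, eval_mul,
    Chebyshev.U_eval_one, eval_intCast] at h
  push_cast at h
  rw [abs_mul, abs_of_pos hpos] at h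
  exact le_of_mul_le_mul_left h hpos

lemma eval_U_sq_mul_le (m : ℕ) {x : ℝ} (hx : |x| ≤ 1) :
    (Chebyshev.U ℝ m).eval x ^ 2 * (1 - x ^ 2) ≤ 1 := by
  obtain ⟨h1, h2⟩ := abs_le.1 hx
  have h := Chebyshev.U_real_cos (Real.arccos x) m
  rw [Real.cos_arccos h1 h2] at h
  calc (Chebyshev.U ℝ m).eval x ^ 2 * (1 - x ^ 2)
      = ((Chebyshev.U ℝ m).eval x * Real.sin (Real.arccos x)) ^ 2 := by
        rw [mul_pow, Real.sin_sq, Real.cos_arccos h1 h2]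
    _ ≤ 1 := by rw [h]; exact Real.sin_sq_le_one _

lemma exists_eval_U_eq_zero {m : ℕ} (hm : 0 < m) :
    ∃ a : ℝ, -1 ≤ a ∧ a < 1 ∧ 1 - a ≤ 5 / ((m : ℝ) + 1) ^ 2 ∧ (Chebyshev.U ℝ m).eval a = 0 := by
  have hM : (1 : ℝ) < m + 1 := by
    have : (0 : ℝ) < m := by exact_mod_cast hm
    linarith
  set t := Real.pi / ((m : ℝ) + 1) with ht
  have ht0 : 0 < t := by positivity
  have htpi : t < Real.pi := div_lt_self Real.pi_pos hM
  have hsin : 0 < Real.sin t := Real.sin_pos_of_pos_of_lt_pi ht0 htpi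
  refine ⟨Real.cos t, Real.neg_one_le_cos t, ?_, ?_, ?_⟩
  · nlinarith [Real.sin_sq_add_cos_sq t, Real.cos_le_one t]
  · have h1 := Real.one_sub_sq_div_two_le_cos (x := t)
    have h2 : t ^ 2 ≤ 10 / ((m : ℝ) + 1) ^ 2 := by
      rw [ht, div_pow]
      gcongr
      nlinarith [Real.pi_lt_d2, Real.pi_pos]
    have h3 : 10 / ((m : ℝ) + 1) ^ 2 = 2 * (5 / ((m : ℝ) + 1) ^ 2) := by ring
    linarith
  · have h := Chebyshev.U_real_cos t m
    have : (((m : ℤ) : ℝ) + 1) * t = Real.pi := by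
      rw [ht]
      push_cast
      field_simp
    rw [this, Real.sin_pi] at h
    exact (mul_eq_zero.1 h).resolve_right hsin.ne'

lemma integral_inv_sq_add_inv_sq_le {ε : ℝ} (hε : 0 < ε) :
    ∫ x in (-1 : ℝ)..1, (((1 - x + ε) ^ 2)⁻¹ + ((1 + x + ε) ^ 2)⁻¹) ≤ 2 / ε := by
  have hmem : ∀ x ∈ uIcc (-1 : ℝ) 1, 1 - x + ε ≠ 0 ∧ 1 + x + ε ≠ 0 := by
    intro x hx
    rw [uIcc_of_le (by norm_num), mem_Icc] at hx
    constructor <;> apply ne_of_gt <;> linarith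
  rw [intervalIntegral.integral_eq_sub_of_hasDerivAt
    (f := fun x => (1 - x + ε)⁻¹ - (1 + x + ε)⁻¹)]
  · have : 0 < (1 + 1 + ε)⁻¹ := by positivity
    rw [sub_self, zero_add, sub_neg_eq_add, add_neg_cancel, zero_add, div_eq_mul_inv]
    linarith
  · intro x hx
    have h1 : HasDerivAt (fun x : ℝ => 1 - x + ε) (-1) x := by
      simpa using ((hasDerivAt_id x).const_sub 1).add_const ε
    have h2 : HasDerivAt (fun x : ℝ => 1 + x + ε) 1 x := by
      simpa using ((hasDerivAt_id x).const_add 1).add_const ε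
    convert! (h1.fun_inv (hmem x hx).1).sub (h2.fun_inv (hmem x hx).2) using 1
    ring
  · refine ContinuousOn.intervalIntegrable fun x hx => ContinuousAt.continuousWithinAt ?_
    have h1 := pow_ne_zero 2 (hmem x hx).1
    have h2 := pow_ne_zero 2 (hmem x hx).2
    fun_prop (disch := assumption)

/-- A polynomial of degree `n` that is bounded by `1`, equal to `1` at `1`, has a zero within
`O(n⁻²)` of `1`, and has integral `O(n⁻²)`: the normalized product `U_m ^ 4 * X ^ r` with
`n = 4 * m + r`. The factor `X ^ r` adjusts the degree; the fourth power makes the decay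
`(1 - x²)⁻²` away from the endpoints integrable uniformly in `m`. -/
lemma exists_peaked_polynomial {n : ℕ} (hn : 0 < n) : ∃ (Q : ℝ[X]) (M a : ℝ),
    Q.natDegree = n ∧ 0 < M ∧ (n : ℝ) ≤ 4 * M ∧ (∀ x ∈ Icc (-1 : ℝ) 1, |Q.eval x| ≤ 1) ∧
    ∫ x in (-1 : ℝ)..1, |Q.eval x| ≤ 8 / M ^ 2 ∧ Q.eval 1 = 1 ∧ Q.eval a = 0 ∧
    -1 ≤ a ∧ a < 1 ∧ 1 - a ≤ 5 / M ^ 2 := by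
  set m := n / 4 with hm
  set r := n % 4 with hr
  have hnmr : 4 * m + r = n := Nat.div_add_mod n 4
  have hr4 : r < 4 := Nat.mod_lt _ (by norm_num)
  set M : ℝ := m + 1 with hM
  have hM0 : 0 < M := by positivity
  set U := Chebyshev.U ℝ m with hU
  have hUdeg : U.natDegree = m := Chebyshev.natDegree_U_natCast ℝ m
  have hU1 : U.eval 1 = M := by simp [hU, hM, Chebyshev.U_eval_one]
  have hU0 : U ≠ 0 := fun h => by rw [h, eval_zero] at hU1; exact hM0.ne hU1
  have hz : ∃ a : ℝ, -1 ≤ a ∧ a < 1 ∧ 1 - a ≤ 5 / M ^ 2 ∧ U.eval a ^ 4 * a ^ r = 0 := by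
    rcases Nat.eq_zero_or_pos m with h0 | hpos
    · refine ⟨0, by norm_num, by norm_num, ?_, ?_⟩
      · rw [hM, h0]
        norm_num
      · rw [zero_pow (by omega), mul_zero]
    · obtain ⟨a, h1, h2, h3, h4⟩ := exists_eval_U_eq_zero hpos
      exact ⟨a, h1, h2, h3, by rw [h4]; ring⟩
  obtain ⟨a, ha1, ha2, ha3, ha4⟩ := hz
  have heval : ∀ x, (C (M ^ 4)⁻¹ * (U ^ 4 * X ^ r)).eval x = (M ^ 4)⁻¹ * (U.eval x ^ 4 * x ^ r) := by
    intro x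
    simp
  have habs : ∀ x ∈ Icc (-1 : ℝ) 1,
      |(C (M ^ 4)⁻¹ * (U ^ 4 * X ^ r)).eval x| ≤ (M ^ 4)⁻¹ * U.eval x ^ 4 := by
    intro x hx
    have hx' : |x| ≤ 1 := abs_le.2 hx
    rw [heval, abs_mul, abs_of_pos (by positivity), abs_mul, abs_pow x,
      abs_of_nonneg (Even.pow_nonneg (by decide) (U.eval x))]
    exact mul_le_mul_of_nonneg_left (mul_le_of_le_one_right (Even.pow_nonneg (by decide) _)
      (pow_le_one₀ (abs_nonneg x) hx')) (by positivity)
  refine ⟨C (M ^ 4)⁻¹ * (U ^ 4 * X ^ r), M, a, ?_, hM0, ?_, ?_, ?_, ?_, ?_, ha1, ha2, ha3⟩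
  · rw [natDegree_C_mul (by positivity), natDegree_mul (pow_ne_zero _ hU0)
      (pow_ne_zero _ X_ne_zero), natDegree_pow, natDegree_X_pow, hUdeg, hnmr]
  · have : n ≤ 4 * (m + 1) := by omega
    rw [hM]
    exact_mod_cast this
  · intro x hx
    refine (habs x hx).trans ?_
    rw [inv_mul_le_one₀ (by positivity), ← Even.pow_abs (by decide) (U.eval x)]
    gcongr
    exact abs_eval_U_le m (abs_le.2 hx)
  · set ε : ℝ := (M ^ 2)⁻¹ with hε
    have hε0 : 0 < ε := by positivity
    have hpt : ∀ x ∈ Icc (-1 : ℝ) 1, |(C (M ^ 4)⁻¹ * (U ^ 4 * X ^ r)).eval x| ≤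
        4 * (M ^ 4)⁻¹ * (((1 - x + ε) ^ 2)⁻¹ + ((1 + x + ε) ^ 2)⁻¹) := by
      intro x hx
      refine (habs x hx).trans ?_
      rw [mul_comm (4 : ℝ), mul_assoc]
      gcongr
      have hV0 := sq_nonneg (U.eval x)
      have hV1 : U.eval x ^ 2 * (1 - x ^ 2) ≤ 1 := eval_U_sq_mul_le m (abs_le.2 hx)
      have hV2 : U.eval x ^ 2 * ε ≤ 1 := by
        rw [hε, mul_inv_le_iff₀ (by positivity), one_mul, ← sq_abs]
        gcongr
        exact abs_eval_U_le m (abs_le.2 hx)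
      -- `d` is the distance to the nearer endpoint, and `d ≤ 1 - x ^ 2`
      have hd : ∀ d, 0 ≤ d → d ≤ 1 - x ^ 2 → U.eval x ^ 4 ≤ 4 * ((d + ε) ^ 2)⁻¹ := by
        intro d hd0 hd
        have h1 : U.eval x ^ 2 * (d + ε) ≤ 2 := by nlinarith
        have h2 : 0 ≤ U.eval x ^ 2 * (d + ε) := by positivity
        rw [← div_eq_mul_inv, le_div_iff₀ (by positivity)]
        nlinarith
      have hp1 : 0 ≤ ((1 - x + ε) ^ 2)⁻¹ := by positivity
      have hp2 : 0 ≤ ((1 + x + ε) ^ 2)⁻¹ := by positivity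
      rcases le_total 0 x with h0 | h0
      · have := hd (1 - x) (by linarith [hx.2]) (by nlinarith [hx.2])
        linarith
      · have := hd (1 + x) (by linarith [hx.1]) (by nlinarith [hx.1])
        linarith
    have hden : ∀ x ∈ uIcc (-1 : ℝ) 1, (1 - x + ε) ^ 2 ≠ 0 ∧ (1 + x + ε) ^ 2 ≠ 0 := by
      intro x hx
      rw [uIcc_of_le (by norm_num), mem_Icc] at hx
      constructor <;> apply pow_ne_zero <;> apply ne_of_gt <;> linarith
    calc ∫ x in (-1 : ℝ)..1, |(C (M ^ 4)⁻¹ * (U ^ 4 * X ^ r)).eval x|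
        ≤ ∫ x in (-1 : ℝ)..1, 4 * (M ^ 4)⁻¹ * (((1 - x + ε) ^ 2)⁻¹ + ((1 + x + ε) ^ 2)⁻¹) := by
          refine intervalIntegral.integral_mono_on (by norm_num) ?_ ?_ hpt
          · exact (Polynomial.continuous _).abs.intervalIntegrable _ _
          · refine ContinuousOn.intervalIntegrable fun x hx => ContinuousAt.continuousWithinAt ?_
            obtain ⟨h1, h2⟩ := hden x hx
            fun_prop (disch := assumption)
      _ ≤ 4 * (M ^ 4)⁻¹ * (2 / ε) := by
          rw [intervalIntegral.integral_const_mul]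
          gcongr
          exact integral_inv_sq_add_inv_sq_le hε0
      _ = 8 / M ^ 2 := by
          rw [hε]
          field_simp
          norm_num
  · rw [heval, hU1, one_pow, mul_one, inv_mul_cancel₀ (by positivity)]
  · rw [heval, ha4, mul_zero]

/-! ### The lower bound -/

/-- If the modular of `Q' / L` is at most `1`, then Jensen's inequality on `[a, 1]`, where `Q` grows
from `0` to `1`, bounds `N` at `M ^ 2 / (5 * L)`. -/
lemma apply_le_of_lintegral_derivative_le {N : ℝ → ℝ} (hN : IsNOrlicz N) {Q : ℝ[X]} {M a L : ℝ}
    (hM : 0 < M) (ha : -1 ≤ a) (ha1 : a < 1) (haM : 1 - a ≤ 5 / M ^ 2) (hQ1 : Q.eval 1 = 1)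
    (hQa : Q.eval a = 0) (hL : 0 < L)
    (h : ∫⁻ x, ENNReal.ofReal (N (|Q.derivative.eval x| / L)) ∂normLebesgue ≤ 1) :
    N (M ^ 2 / (5 * L)) ≤ 2 * M ^ 2 / 5 := by
  set δ := 1 - a with hδ
  have hδ0 : 0 < δ := sub_pos.2 ha1
  have hcf : Continuous fun x => |Q.derivative.eval x| / L := by fun_prop
  have hcN : Continuous fun x => N (|Q.derivative.eval x| / L) := hN.continuous.comp hcf
  have hvol : volume.real (Icc a 1) = δ := by
    rw [Real.volume_real_Icc_of_le ha1.le]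
  have hint : ∫ x in Icc a 1, N (|Q.derivative.eval x| / L) ≤ 2 := by
    have h1 : ENNReal.ofReal (∫ x in Icc a 1, N (|Q.derivative.eval x| / L)) ≤ 2 := by
      rw [ofReal_integral_eq_lintegral_ofReal (hcN.integrableOn_Icc)
        (Filter.Eventually.of_forall fun x => hN.nonneg _)]
      rw [lintegral_normLebesgue, mul_comm, ← div_eq_mul_inv] at h
      refine (lintegral_mono_set (Icc_subset_Icc_left ha)).trans ?_
      have := ENNReal.div_le_iff_le_mul (Or.inl two_ne_zero) (Or.inl ENNReal.ofNat_ne_top) |>.1 h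
      simpa using this
    exact (ENNReal.ofReal_le_ofNat).1 h1
  have havg : 1 / (δ * L) ≤ ⨍ x in Icc a 1, |Q.derivative.eval x| / L := by
    rw [setAverage_eq, hvol, smul_eq_mul, integral_div, one_div, mul_inv, div_eq_mul_inv]
    have hftc : (1 : ℝ) = ∫ x in a..1, Q.derivative.eval x := by
      rw [intervalIntegral.integral_eq_sub_of_hasDerivAt (fun x _ => Q.hasDerivAt x)
        ((Polynomial.continuous _).intervalIntegrable _ _), hQ1, hQa, sub_zero]
    have h1 : (1 : ℝ) ≤ ∫ x in Icc a 1, |Q.derivative.eval x| := by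
      rw [integral_Icc_eq_integral_Ioc, ← intervalIntegral.integral_of_le ha1.le]
      calc (1 : ℝ) = |∫ x in a..1, Q.derivative.eval x| := by rw [← hftc, abs_one]
        _ ≤ _ := intervalIntegral.abs_integral_le_integral_abs ha1.le
    gcongr
    exact le_mul_of_one_le_left (by positivity) h1
  have hJ : N (1 / (δ * L)) ≤ δ⁻¹ * 2 := by
    have := hN.convexOn.map_set_average_le hN.continuous.continuousOn isClosed_univ
      (μ := volume) (t := Icc a 1) (f := fun x => |Q.derivative.eval x| / L)
      (by rw [Real.volume_Icc]; simpa using ha1) (by simp) (by simp)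
      hcf.integrableOn_Icc hcN.integrableOn_Icc
    have h2 : N (1 / (δ * L)) ≤ N (⨍ x in Icc a 1, |Q.derivative.eval x| / L) := by
      refine hN.apply_le_apply ?_
      rw [abs_of_nonneg (by positivity)]
      exact havg.trans (le_abs_self _)
    refine (h2.trans this).trans ?_
    rw [setAverage_eq, hvol, smul_eq_mul]
    gcongr
  -- passing from the length `δ` to its bound `5 / M ^ 2` costs nothing, as `N u / u` increases
  have ht1 : δ * M ^ 2 / 5 ≤ 1 := by
    rw [le_div_iff₀ (by positivity)] at haM
    linarith
  calc N (M ^ 2 / (5 * L)) = N (δ * M ^ 2 / 5 * (1 / (δ * L))) := by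
        congr 1
        field_simp
    _ ≤ δ * M ^ 2 / 5 * N (1 / (δ * L)) := hN.apply_mul_le (by positivity) ht1 _
    _ ≤ δ * M ^ 2 / 5 * (δ⁻¹ * 2) := by gcongr
    _ = 2 * M ^ 2 / 5 := by field_simp

/-- For `|Q| ≤ 1` convexity gives `N (|Q| / l) ≤ |Q| * N (1 / l)`, so the modular of `Q / l` is
controlled by the integral of `|Q|`. -/
lemma lintegral_normLebesgue_le_of_abs_le_one {N : ℝ → ℝ} (hN : IsNOrlicz N) {Q : ℝ[X]} {A l : ℝ}
    (hQ : ∀ x ∈ Icc (-1 : ℝ) 1, |Q.eval x| ≤ 1) (hA : ∫ x in (-1 : ℝ)..1, |Q.eval x| ≤ A)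
    (h : A * N (1 / l) ≤ 2) :
    ∫⁻ x, ENNReal.ofReal (N (|Q.eval x| / l)) ∂normLebesgue ≤ 1 := by
  rw [lintegral_normLebesgue, mul_comm, ← div_eq_mul_inv]
  refine ENNReal.div_le_of_le_mul ?_
  rw [one_mul]
  have hN0 := hN.nonneg (1 / l)
  have hc : Continuous fun x => |Q.eval x| * N (1 / l) := by fun_prop
  calc ∫⁻ x in Icc (-1) 1, ENNReal.ofReal (N (|Q.eval x| / l))
      ≤ ∫⁻ x in Icc (-1) 1, ENNReal.ofReal (|Q.eval x| * N (1 / l)) := by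
        refine setLIntegral_mono' measurableSet_Icc fun x hx => ENNReal.ofReal_le_ofReal ?_
        rw [div_eq_mul_one_div]
        exact hN.apply_mul_le (abs_nonneg _) (hQ x hx) _
    _ = ENNReal.ofReal (∫ x in Icc (-1) 1, |Q.eval x| * N (1 / l)) :=
        (ofReal_integral_eq_lintegral_ofReal hc.integrableOn_Icc
          (Filter.Eventually.of_forall fun x => by positivity)).symm
    _ ≤ ENNReal.ofReal 2 := by
        refine ENNReal.ofReal_le_ofReal ?_
        rw [integral_Icc_eq_integral_Ioc, ← intervalIntegral.integral_of_le (by norm_num),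
          intervalIntegral.integral_mul_const]
        exact (mul_le_mul_of_nonneg_right hA hN0).trans h
    _ = 2 := ENNReal.ofReal_ofNat 2

lemma exists_natDegree_eq_le_orliczNorm_div {N : ℝ → ℝ} (hN : IsNOrlicz N) {n : ℕ} (hn : 0 < n) :
    ∃ Q : ℝ[X], Q.natDegree = n ∧ ENNReal.ofReal (1 / 128 * (n : ℝ) ^ 2) ≤
      orliczNorm N (fun x => Q.derivative.eval x) / orliczNorm N (fun x => Q.eval x) := by
  obtain ⟨Q, M, a, hdeg, hM, hnM, hQ, hint, hQ1, hQa, ha, ha1, haM⟩ := exists_peaked_polynomial hn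
  have hN1 : 0 < N 1 := (hN.nonneg 1).lt_of_ne fun h => one_ne_zero ((hN.eq_zero_iff 1).1 h.symm)
  have hup : ∀ L, 0 < L →
      ∫⁻ x, ENNReal.ofReal (N (|Q.derivative.eval x| / L)) ∂normLebesgue ≤ 1 →
      N (M ^ 2 / (5 * L)) ≤ 2 * M ^ 2 / 5 := fun L hL =>
    apply_le_of_lintegral_derivative_le hN hM ha ha1 haM hQ1 hQa hL
  -- the two norms are neither both `0` nor both `∞`, so that the quotient is meaningful
  have hpos : orliczNorm N (fun x => Q.derivative.eval x) ≠ 0 := by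
    set u := max 1 ((2 * M ^ 2 / 5 + 1) / N 1) with hu
    have hu1 : 1 ≤ u := le_max_left _ _
    have huN : 2 * M ^ 2 / 5 < N u := by
      have h1 := hN.mul_le_apply_mul hu1 1
      have h2 : (2 * M ^ 2 / 5 + 1) / N 1 ≤ u := le_max_right _ _
      rw [div_le_iff₀ hN1] at h2
      rw [mul_one] at h1
      linarith
    have hle : ENNReal.ofReal (M ^ 2 / (5 * u)) ≤ orliczNorm N (fun x => Q.derivative.eval x) := by
      refine le_iInf₂ fun L hL => ENNReal.ofReal_le_ofReal ?_
      by_contra! hlt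
      have hL0 := hL.1
      have h5 : u ≤ M ^ 2 / (5 * L) := by
        rw [lt_div_iff₀ (by positivity)] at hlt
        rw [le_div_iff₀ (by positivity)]
        linarith
      have : N u ≤ N (M ^ 2 / (5 * L)) := hN.apply_le_apply (by
        rw [abs_of_nonneg (by positivity), abs_of_nonneg (by positivity)]
        exact h5)
      linarith [hup L hL.1 hL.2]
    refine (lt_of_lt_of_le (ENNReal.ofReal_pos.2 ?_) hle).ne'
    positivity
  have hfin : orliczNorm N (fun x => Q.eval x) ≠ ⊤ := by
    set l := max 1 (8 / M ^ 2 * N 1) with hl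
    have hl1 : 1 ≤ l := le_max_left _ _
    have hl0 : 0 < l := by linarith
    refine ((orliczNorm_le hl0 (lintegral_normLebesgue_le_of_abs_le_one hN hQ hint ?_)).trans_lt
      ENNReal.ofReal_lt_top).ne
    have h1 := hN.apply_mul_le (t := 1 / l) (by positivity) (by rw [div_le_one hl0]; exact hl1) 1
    rw [mul_one] at h1
    calc 8 / M ^ 2 * N (1 / l) ≤ 8 / M ^ 2 * (1 / l * N 1) := by gcongr
      _ = 8 / M ^ 2 * N 1 / l := by ring
      _ ≤ 1 := div_le_one_of_le₀ (le_max_right _ _) hl0.le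
      _ ≤ 2 := one_le_two
  refine ⟨Q, hdeg, ?_⟩
  rw [ENNReal.le_div_iff_mul_le (Or.inr hpos) (Or.inl hfin)]
  have hcmp : orliczNorm N (fun x => Q.eval x) ≤
      ENNReal.ofReal (8 / M ^ 2) * orliczNorm N (fun x => Q.derivative.eval x) := by
    refine le_mul_orliczNorm (by positivity) fun L hL h => orliczNorm_le (by positivity) ?_
    refine lintegral_normLebesgue_le_of_abs_le_one hN hQ hint ?_
    have h1 := hN.apply_mul_le (t := 5 / 8) (by norm_num) (by norm_num) (M ^ 2 / (5 * L))
    have h2 := hup L hL h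
    calc 8 / M ^ 2 * N (1 / (8 / M ^ 2 * L)) = 8 / M ^ 2 * N (5 / 8 * (M ^ 2 / (5 * L))) := by
          congr 2
          field_simp
      _ ≤ 8 / M ^ 2 * (5 / 8 * (2 * M ^ 2 / 5)) := by
          gcongr
          linarith
      _ = 2 := by field_simp
  calc ENNReal.ofReal (1 / 128 * (n : ℝ) ^ 2) * orliczNorm N (fun x => Q.eval x)
      ≤ ENNReal.ofReal (M ^ 2 / 8) *
        (ENNReal.ofReal (8 / M ^ 2) * orliczNorm N (fun x => Q.derivative.eval x)) := by
        refine mul_le_mul' (ENNReal.ofReal_le_ofReal ?_) hcmp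
        have : (n : ℝ) ^ 2 ≤ (4 * M) ^ 2 := by gcongr
        linarith
    _ = orliczNorm N (fun x => Q.derivative.eval x) := by
        rw [← mul_assoc, ← ENNReal.ofReal_mul (by positivity),
          show M ^ 2 / 8 * (8 / M ^ 2) = 1 by field_simp, ENNReal.ofReal_one, one_mul]

/-! ### Existence of admissible constants -/

lemma ConvexOn.exists_subgradient {f : ℝ → ℝ} (hf : ConvexOn ℝ univ f) (x : ℝ) :
    ∃ p, ∀ y, f x + p * (y - x) ≤ f y := by
  refine ⟨derivWithin f (Ioi x) x, fun y => ?_⟩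
  have hx : x ∈ interior (univ : Set ℝ) := by simp
  rcases lt_trichotomy x y with h | rfl | h
  · have := hf.rightDeriv_le_slope_of_mem_interior hx (mem_univ y) h
    rw [slope_def_field, le_div_iff₀ (sub_pos.2 h)] at this
    linarith
  · simp
  · have := (hf.slope_le_leftDeriv_of_mem_interior (mem_univ y) hx h).trans
      (hf.leftDeriv_le_rightDeriv_of_mem_interior hx)
    rw [slope_def_field, div_le_iff₀ (sub_pos.2 h)] at this
    linarith

lemma convexOn_of_exists_minorant {N : ℝ → ℝ}
    (h : ∀ z, ∃ F : ℝ → ℝ, ConvexOn ℝ univ F ∧ F z = N z ∧ ∀ u, F u ≤ N u) :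
    ConvexOn ℝ univ N := by
  refine ⟨convex_univ, fun x _ y _ a b ha hb hab => ?_⟩
  obtain ⟨F, hF, hz, hle⟩ := h (a • x + b • y)
  rw [← hz]
  refine (hF.2 (mem_univ x) (mem_univ y) ha hb hab).trans ?_
  gcongr
  · exact hle x
  · exact hle y

lemma convexOn_const_mul_abs_rpow {c p : ℝ} (hc : 0 ≤ c) (hp : 1 ≤ p) :
    ConvexOn ℝ univ fun u : ℝ => c * |u| ^ p := by
  refine ⟨convex_univ, fun x _ y _ a b ha hb hab => ?_⟩
  have h := (convexOn_rpow hp).2 (mem_Ici.2 (abs_nonneg x)) (mem_Ici.2 (abs_nonneg y)) ha hb hab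
  simp only [smul_eq_mul] at h ⊢
  calc c * |a * x + b * y| ^ p ≤ c * (a * |x| + b * |y|) ^ p := by
        gcongr
        refine (abs_add_le _ _).trans_eq ?_
        rw [abs_mul, abs_mul, abs_of_nonneg ha, abs_of_nonneg hb]
    _ ≤ c * (a * |x| ^ p + b * |y| ^ p) := by gcongr
    _ = _ := by ring

/-- The terms of a convergent series tend to zero, so the increments of `h` tend to infinity. -/
lemma IsPhi.exists_one_le_sub {φ : ℝ → ℝ} (hφ : IsPhi φ) :
    ∃ y, 1 ≤ expComp φ (y + 1) - expComp φ y := by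
  by_contra! hlt
  have hinf : Infinite {k : ℕ // 3 ≤ k} := (Set.Ici_infinite (3 : ℕ)).to_subtype
  have hconst : Summable fun _ : {k : ℕ // 3 ≤ k} => Real.exp (-1) := by
    refine Summable.of_nonneg_of_le (fun _ => (Real.exp_pos _).le) (fun k => ?_) hφ.summable
    gcongr
    linarith [hlt (k : ℕ)]
  exact (Real.exp_pos (-1)).ne' ((summable_const_iff _).1 hconst)

lemma expOrlicz_of_le {φ : ℝ → ℝ} {C₁ C₂ u : ℝ} (h : |u| ≤ C₁) :
    expOrlicz φ C₁ C₂ u = C₂ * |u| := if_pos h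

lemma expOrlicz_of_lt {φ : ℝ → ℝ} {C₁ C₂ u : ℝ} (h : C₁ < |u|) :
    expOrlicz φ C₁ C₂ u = Real.exp (φ |u|) := if_neg h.not_ge

lemma IsPhi.strictMonoOn {φ : ℝ → ℝ} (hφ : IsPhi φ) : StrictMonoOn φ (Ioi 0) := by
  intro u hu v hv huv
  have := hφ.strictMono (Real.log_lt_log hu huv)
  rwa [expComp, expComp, Real.exp_log hu, Real.exp_log hv] at this

/-- Once the slope of `h` is at least `1`, the line `C₂ |u|` through the origin and the graph of
`exp ∘ φ` at `C₁ = exp y₀` gives an Orlicz function. Convexity comes from convex minorants that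
touch it: `C₂ |u|` where `|u| ≤ C₁`, and elsewhere the powers `c |u| ^ p`, which correspond to the
supporting lines of `h` of slope `p ≥ 1`. -/
lemma IsPhi.isAdmissible {φ : ℝ → ℝ} (hφ : IsPhi φ) {y₀ p₀ : ℝ} (hp₀ : 1 ≤ p₀)
    (h₀ : ∀ y, expComp φ y₀ + p₀ * (y - y₀) ≤ expComp φ y) :
    IsAdmissible φ (Real.exp y₀) (Real.exp (expComp φ y₀ - y₀)) := by
  set h := expComp φ
  set C₁ := Real.exp y₀ with hC₁
  set C₂ := Real.exp (h y₀ - y₀) with hC₂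
  have hC₁0 : 0 < C₁ := Real.exp_pos _
  have hC₂0 : 0 < C₂ := Real.exp_pos _
  have hglue : C₂ * C₁ = Real.exp (φ C₁) := by
    rw [hC₂, hC₁, ← Real.exp_add, sub_add_cancel]
    rfl
  have hlarge : ∀ y, y₀ < y → expOrlicz φ C₁ C₂ (Real.exp y) = Real.exp (h y) := by
    intro y hy
    rw [expOrlicz_of_lt (by rw [Real.abs_exp]; exact Real.exp_lt_exp.2 hy), Real.abs_exp]
    rfl
  have hsmall : ∀ y, y ≤ y₀ → expOrlicz φ C₁ C₂ (Real.exp y) = Real.exp (h y₀ - y₀ + y) := by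
    intro y hy
    rw [expOrlicz_of_le (by rw [Real.abs_exp]; exact Real.exp_le_exp.2 hy), Real.abs_exp, hC₂,
      Real.exp_add]
  have heven : ∀ u, expOrlicz φ C₁ C₂ |u| = expOrlicz φ C₁ C₂ u := by
    intro u
    simp [expOrlicz]
  -- a power minorant only has to be checked in the logarithmic variable
  have hminor : ∀ b p : ℝ, 1 ≤ p → (∀ y ≤ y₀, b + p * y ≤ h y₀ - y₀ + y) →
      (∀ y, y₀ < y → b + p * y ≤ h y) → ∀ u, Real.exp b * |u| ^ p ≤ expOrlicz φ C₁ C₂ u := by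
    intro b p hp h1 h2 u
    rcases eq_or_ne u 0 with rfl | hu
    · rw [abs_zero, Real.zero_rpow (by linarith), expOrlicz_of_le (by simpa using hC₁0.le)]
      simp
    · have hu0 : 0 < |u| := abs_pos.2 hu
      rw [← heven, ← Real.exp_log hu0, ← Real.exp_mul, ← Real.exp_add, mul_comm (Real.log _)]
      rcases le_or_gt (Real.log |u|) y₀ with hy | hy
      · rw [hsmall _ hy]
        exact Real.exp_le_exp.2 (h1 _ hy)
      · rw [hlarge _ hy]
        exact Real.exp_le_exp.2 (h2 _ hy)
  refine ⟨hC₁0, hC₂0, fun u => by simp [expOrlicz], ?_, ?_, ?_, ?_, ?_⟩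
  · have hc : Continuous fun u : ℝ => φ |u| :=
      hφ.continuousOn.comp_continuous continuous_abs fun u => abs_nonneg u
    refine Continuous.if_le (by fun_prop) hc.rexp continuous_abs continuous_const fun u hu => ?_
    rw [hu, hglue]
  · refine convexOn_of_exists_minorant fun z => ?_
    rcases le_or_gt |z| C₁ with hz | hz
    · refine ⟨fun u => C₂ * |u| ^ (1 : ℝ), convexOn_const_mul_abs_rpow hC₂0.le le_rfl, ?_, ?_⟩
      · simp only [expOrlicz_of_le hz, Real.rpow_one]
      · refine hminor (h y₀ - y₀) 1 le_rfl (fun y _ => by rw [one_mul]) fun y hy => ?_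
        nlinarith [h₀ y]
    · have hz0 : 0 < |z| := hC₁0.trans hz
      set w := Real.log |z| with hw
      have hwy : y₀ < w := (Real.lt_log_iff_exp_lt hz0).2 hz
      obtain ⟨p, hp⟩ := hφ.convexOn.exists_subgradient w
      have hp1 : 1 ≤ p := by
        have h1 := hp y₀
        have h2 := h₀ w
        nlinarith
      refine ⟨fun u => Real.exp (h w - p * w) * |u| ^ p,
        convexOn_const_mul_abs_rpow (Real.exp_pos _).le hp1, ?_, ?_⟩
      · dsimp only
        rw [← heven, ← Real.exp_log hz0, ← hw, hlarge _ hwy, ← Real.exp_mul, ← Real.exp_add]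
        ring_nf
      · refine hminor _ p hp1 (fun y hy => ?_) fun y _ => ?_
        · nlinarith [hp y₀]
        · linarith [hp y]
  · intro u
    rw [expOrlicz]
    split_ifs <;> positivity
  · intro u
    rw [expOrlicz]
    split_ifs with hu
    · simp [hC₂0.ne']
    · have : u ≠ 0 := by
        rintro rfl
        exact hu (by simpa using hC₁0.le)
      simp [this, (Real.exp_pos _).ne']
  · intro u hu v hv huv
    rw [mem_Ici] at hu hv
    have hv0 : 0 < v := hu.trans_lt huv
    rcases le_or_gt v C₁ with hvC | hvC
    · rw [expOrlicz_of_le (by rw [abs_of_nonneg hu]; linarith),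
        expOrlicz_of_le (by rwa [abs_of_nonneg hv]), abs_of_nonneg hu, abs_of_nonneg hv]
      gcongr
    · rw [expOrlicz_of_lt (u := v) (by rwa [abs_of_nonneg hv]), abs_of_nonneg hv]
      rcases le_or_gt u C₁ with huC | huC
      · rw [expOrlicz_of_le (by rwa [abs_of_nonneg hu]), abs_of_nonneg hu]
        calc C₂ * u ≤ C₂ * C₁ := by gcongr
          _ = Real.exp (φ C₁) := hglue
          _ < Real.exp (φ v) := Real.exp_lt_exp.2 (hφ.strictMonoOn hC₁0 hv0 hvC)
      · rw [expOrlicz_of_lt (by rwa [abs_of_nonneg hu]), abs_of_nonneg hu]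
        exact Real.exp_lt_exp.2 (hφ.strictMonoOn (hC₁0.trans huC) hv0 huv)

lemma IsPhi.exists_isAdmissible {φ : ℝ → ℝ} (hφ : IsPhi φ) :
    ∃ C₁ C₂ : ℝ, IsAdmissible φ C₁ C₂ := by
  obtain ⟨y, hy⟩ := hφ.exists_one_le_sub
  obtain ⟨p, hp⟩ := hφ.convexOn.exists_subgradient (y + 1)
  exact ⟨_, _, hφ.isAdmissible (by linarith [hp y]) hp⟩

/-! ### The constants -/

lemma one_le_baranK_four : 1 ≤ baranK 4 := by
  rw [baranK, show 2 * Real.pi / 4 = Real.pi / 2 by ring, Real.sin_pi_div_two]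
  refine Real.one_le_rpow ?_ (by norm_num)
  linarith [Real.pi_gt_three]

lemma IsAdmissible.mul_le_expOrlicz {φ : ℝ → ℝ} {C₁ C₂ : ℝ} (h : IsAdmissible φ C₁ C₂) {u : ℝ}
    (hu : C₁ ≤ u) : C₂ * u ≤ expOrlicz φ C₁ C₂ u := by
  have h1 := h.isNOrlicz.mul_le_apply_mul (t := u / C₁) ((one_le_div h.pos₁).2 hu) C₁
  have hC : expOrlicz φ C₁ C₂ C₁ = C₂ * C₁ := by
    rw [expOrlicz_of_le (abs_of_pos h.pos₁).le, abs_of_pos h.pos₁]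
  rw [hC, div_mul_cancel₀ _ h.pos₁.ne'] at h1
  refine le_of_eq_of_le ?_ h1
  have := h.pos₁.ne'
  field_simp

/-- As `exp (k₀ - 2)` is at least `exp 3` and exceeds `C₁`, convexity gives
`N (exp (k₀ - 2)) ≥ C₂ * exp 3`, and `C₃ ≥ 1 / C₂`. -/
lemma IsAdmissible.exp_five_le_constC4_mul_constC3 {φ : ℝ → ℝ} {C₁ C₂ : ℝ}
    (h : IsAdmissible φ C₁ C₂) : Real.exp 5 ≤ constC4 φ C₁ C₂ * constC3 C₁ C₂ := by
  set k := constK0 φ C₁ with hk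
  have hk0 : 4 + max (Real.log C₁) 1 ≤ k := le_max_left _ _
  have hk1 := le_max_left (Real.log C₁) 1
  have hk2 := le_max_right (Real.log C₁) 1
  have hC₂ := h.pos₂
  have hN : C₂ * Real.exp 3 ≤ expOrlicz φ C₁ C₂ (Real.exp (k - 2)) := by
    refine le_trans ?_ (h.mul_le_expOrlicz ((Real.log_le_iff_le_exp h.pos₁).1 (by linarith)))
    gcongr
    linarith
  have hC₃ : 1 / C₂ ≤ constC3 C₁ C₂ := (le_max_right _ _).trans (le_max_right _ _)
  have hC₄ : Real.exp 2 * (C₂ * Real.exp 3) ≤ constC4 φ C₁ C₂ := by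
    rw [constC4]
    gcongr
    exact hN.trans (le_add_of_nonneg_right (tsum_nonneg fun _ => (Real.exp_pos _).le))
  calc Real.exp 5 = Real.exp 2 * (C₂ * Real.exp 3) * (1 / C₂) := by
        rw [show (5 : ℝ) = 2 + 3 by norm_num, Real.exp_add]
        field_simp
    _ ≤ constC4 φ C₁ C₂ * constC3 C₁ C₂ :=
        mul_le_mul hC₄ hC₃ (by positivity) (le_trans (by positivity) hC₄)

theorem theorem1 (φ : ℝ → ℝ) (hφ : IsPhi φ) :
    (∃ C₁ C₂ : ℝ, IsAdmissible φ C₁ C₂) ∧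
    ∀ C₁ C₂ : ℝ, IsAdmissible φ C₁ C₂ →
      ∃ C₅ : ℝ, 0 < C₅ ∧ ∀ n : ℕ,
        ENNReal.ofReal (C₅ * (n : ℝ) ^ 2) ≤ markovConst φ C₁ C₂ n ∧
        markovConst φ C₁ C₂ n ≤
          ENNReal.ofReal ((n : ℝ) ^ 2 * baranK 4 * max 1 (psiFun φ 4) *
            constC4 φ C₁ C₂ * constC3 C₁ C₂) := by
  refine ⟨hφ.exists_isAdmissible, fun C₁ C₂ h => ⟨1 / 128, by norm_num, fun n => ⟨?_, ?_⟩⟩⟩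
  · rcases Nat.eq_zero_or_pos n with rfl | hn
    · simp
    · obtain ⟨Q, hdeg, hQ⟩ := exists_natDegree_eq_le_orliczNorm_div h.isNOrlicz hn
      have hQ0 : Q ≠ 0 := by
        rintro rfl
        rw [natDegree_zero] at hdeg
        exact hn.ne hdeg
      exact hQ.trans (le_iSup₂_of_le Q ⟨hQ0, hdeg⟩ le_rfl)
  · refine iSup₂_le fun Q hQ => ENNReal.div_le_of_le_mul ?_
    refine (orliczNorm_derivative_le h.isNOrlicz Q).trans
      (mul_le_mul' (ENNReal.ofReal_le_ofReal ?_) le_rfl)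
    have hC := h.exp_five_le_constC4_mul_constC3
    have h4 : (4 : ℝ) ≤ constC4 φ C₁ C₂ * constC3 C₁ C₂ := by
      linarith [Real.add_one_le_exp (5 : ℝ)]
    have hK := one_le_baranK_four
    have hψ := le_max_left 1 (psiFun φ 4)
    rw [hQ.2]
    calc 4 * (n : ℝ) ^ 2 = (n : ℝ) ^ 2 * (1 * 1 * 4) := by ring
      _ ≤ (n : ℝ) ^ 2 * (baranK 4 * max 1 (psiFun φ 4) *
          (constC4 φ C₁ C₂ * constC3 C₁ C₂)) := by gcongr
      _ = _ := by ring
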